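/- Let $(X,d)$ be a metric space with at least two points, and let $\mu$ be a Borel measure on $X$ with $0<\mu(B)<\infty$ for every open ball $B=B(x,r)=\{y: d(x,y)<r\}$, $x\in X$, $r>0$. Assume that $\mu$ is doubling: there is a constant $c_\mu>1$ with $\mu(B(x,2r))\le c_\mu\,\mu(B(x,r))$ for all $x\in X$ and $r>0$. For a nonempty set $E\subset X$ put $D_E=\operatorname{diam}(E)$ if $\operatorname{diam}(E)>0$, and $D_E=\operatorname{diam}(X)$ if $\operatorname{diam}(E)=0$ (so $D_E=\infty$ is allowed). **Upper Aikawa condition.** A nonempty set $E\subset X$ satisfies the upper Aikawa condition with exponent $\alpha>0$ if for every $\varepsilon>0$ there is $\delta>0$ such that $$\frac1{\mu(B(z,R))}\int_{B(z,R)}\frac{\mathbf 1_K(y)}{\operatorname{dist}(y,E)^{\alpha}}\,d\mu(y)\ \ge\ \frac{R^{-\alpha}}{\varepsilon}$$ whenever $z\in E$, $0<R<D_E$, and $K\subset X$ is a Borel set with $\mu(B(z,R)\setminus K)\le\delta\,\mu(B(z,R))$. Here the integrand is $\infty$ where $y\in K$ and $\operatorname{dist}(y,E)=0$, and $0$ where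 $y\notin K$. **Truncation.** For a closed set $E\subset X$, $z\in E$ and $r>0$, let $F_0=E\cap\overline{B(z,r/2)}$ and, for $j=1,2,\dots$, $$F_j=\bigcup_{x\in F_{j-1}}E\cap\overline{B(x,2^{-j-1}r)},$$ and let $F=F(E,z,r)=\overline{\bigcup_{j\ge 0}F_j}$; here $\overline{A}$ denotes the closure of $A$ in $X$. **Theorem.** Let $1<q<p<\infty$ and $0<s<1$, and let the closed set $E\subset X$ satisfy the upper Aikawa condition with exponent $\alpha=sq$. Then there is a constant $C>0$ such that for every $z\in E$, every $r$ with $0<r<D_E$, and every Lipschitz function $u:X\to\mathbb R$ with $u=0$ on $F=F(E,z,r)$, $$\int_{B(z,8r)\setminus F}\frac{|u(x)|^p}{\operatorname{dist}(x,F)^{sp}}\,d\mu(x)\ \le\ C\int_{B(z,8r)}\int_{B(z,8r)}\frac{|u(x)-u(y)|^p}{d(x,y)^{sp}\,\mu(B(x,d(x,y)))}\,d\mu(y)\,d\mu(x),$$ where the integrand on the right is taken to be $0$ when $x=y$. -/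

import Mathlib

open MeasureTheory Metric Set
open scoped ENNReal NNReal

/-- `μ` is a doubling measure giving positive finite mass to every ball: the standing assumption
on a metric measure space. -/
structure IsDoublingMeasure {X : Type*} [MetricSpace X] [MeasurableSpace X]
    (μ : Measure X) : Prop where
  ball_pos : ∀ (x : X) (r : ℝ), 0 < r → 0 < μ (ball x r)
  ball_lt_top : ∀ (x : X) (r : ℝ), 0 < r → μ (ball x r) < ∞
  doubling : ∃ c : ℝ, 1 < c ∧
    ∀ (x : X) (r : ℝ), 0 < r → μ (ball x (2 * r)) ≤ ENNReal.ofReal c * μ (ball x r)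

open Classical in
/-- The upper bound for the admissible radii: `diam E` if `diam E > 0`, and `diam X` if
`diam E = 0` (both may be infinite). -/
noncomputable def scaleBound {X : Type*} [MetricSpace X] (E : Set X) : ℝ≥0∞ :=
  if ediam E = 0 then ediam (univ : Set X) else ediam E

/-- The upper Aikawa condition with exponent `α`. All quantities are `[0, ∞]`-valued; the integrand
`1_K(y) / dist(y, E)^α` is `∞` for `y ∈ K` with `dist(y, E) = 0`, and `0` for `y ∉ K`. -/
def UpperAikawa {X : Type*} [MetricSpace X] [MeasurableSpace X]
    (μ : Measure X) (E : Set X) (α : ℝ) : Prop :=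
  E.Nonempty ∧ 0 < α ∧
    ∀ ε : ℝ, 0 < ε → ∃ δ : ℝ, 0 < δ ∧
      ∀ z ∈ E, ∀ R : ℝ, 0 < R → ENNReal.ofReal R < scaleBound E →
        ∀ K : Set X, MeasurableSet K →
          μ (ball z R \ K) ≤ ENNReal.ofReal δ * μ (ball z R) →
            ENNReal.ofReal (R ^ (-α) / ε) ≤
              ⨍⁻ y in ball z R, K.indicator (1 : X → ℝ≥0∞) y / infEDist y E ^ α ∂μ

/-- The sets `F_j` of the truncation procedure: `F_0 = E ∩ closure B(z, r/2)` and
`F_j = ⋃_{x ∈ F_{j-1}} E ∩ closure B(x, 2^{-j-1} r)` for `j ≥ 1`. -/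
def truncationStep {X : Type*} [MetricSpace X] (E : Set X) (z : X) (r : ℝ) : ℕ → Set X
  | 0 => E ∩ closure (ball z (r / 2))
  | j + 1 => ⋃ x ∈ truncationStep E z r j, E ∩ closure (ball x (r / 2 ^ (j + 2)))

/-- The truncation `F` of `E` to the ball `B(z, r)`: the closure of `⋃_j F_j`. -/
def truncation {X : Type*} [MetricSpace X] (E : Set X) (z : X) (r : ℝ) : Set X :=
  closure (⋃ j : ℕ, truncationStep E z r j)

/-- The fractional energy
`∫_B ∫_B |u(x) - u(y)|^p / (d(x,y)^{sp} μ(B(x, d(x,y)))) dμ(y) dμ(x)`, with values in `[0, ∞]`;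
on the diagonal `x = y` the integrand is `0`. -/
noncomputable def fractionalEnergy {X : Type*} [MetricSpace X] [MeasurableSpace X]
    (μ : Measure X) (s p : ℝ) (B : Set X) (u : X → ℝ) : ℝ≥0∞ :=
  ∫⁻ x in B, ∫⁻ y in B,
    ENNReal.ofReal (|u x - u y| ^ p) / (edist x y ^ (s * p) * μ (ball x (dist x y))) ∂μ ∂μ

/-! The proof is a pointwise estimate followed by absorption. Let `D = dist(x, F)`. The truncation
places near `x`, at scale `D`, a ball centred in `E` on which the distances to `E` and to `F` agree.
The upper Aikawa condition on that ball bounds `|u(x)|^p / D^{sp}` by the energy density at `x` plus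
`ε` times an average of `|u|^p / dist(·, F)^{sq}` over nearby points, weighted by `D^{-s(p-q)}`
(`UpperAikawa.measure_ball_mul_le`, `UpperAikawa.pointwise_hardy`). Integrate in `x`. By Tonelli,
the second term is controlled once the weight is integrated over all `x` that see a given `y`. Such
`x` have `D` at least a fixed multiple of `dist(y, F)`, and since `s(p-q) > 0` the dyadic layers sum
geometrically (`IsDoublingMeasure.lintegral_kernel_operator_le`). The result is a constant times `ε`
times the left-hand side, which is finite because `u` is Lipschitz, vanishes on `F`, and `s < 1`. A
small `ε` absorbs it. -/

theorem ENNReal.inv_le_mul_inv_of_le_mul {a b c : ℝ≥0∞} (h : b ≤ c * a) (hb : b ≠ 0)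
    (hb' : b ≠ ∞) : a⁻¹ ≤ c * b⁻¹ := by
  rw [← div_eq_mul_inv, ENNReal.le_div_iff_mul_le (Or.inl hb) (Or.inl hb')]
  calc a⁻¹ * b ≤ a⁻¹ * (c * a) := by gcongr
    _ = c * (a⁻¹ * a) := by ring
    _ ≤ c * 1 := by gcongr; exact ENNReal.inv_mul_le_one a
    _ = c := mul_one c

/-! ### Doubling measures and the dyadic kernel bound -/

namespace IsDoublingMeasure

variable {X : Type*} [MetricSpace X] [MeasurableSpace X] {μ : Measure X}

theorem exists_pow_bound (hμ : IsDoublingMeasure μ) :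
    ∃ c : ℝ≥0∞, c ≠ ∞ ∧ ∀ (n : ℕ) (x : X) (r : ℝ), 0 < r →
      μ (ball x (2 ^ n * r)) ≤ c ^ n * μ (ball x r) := by
  obtain ⟨c, -, hc⟩ := hμ.doubling
  refine ⟨ENNReal.ofReal c, ENNReal.ofReal_ne_top, fun n => ?_⟩
  induction n with
  | zero => intro x r _; simp
  | succ n ih =>
    intro x r hr
    calc μ (ball x (2 ^ (n + 1) * r)) = μ (ball x (2 * (2 ^ n * r))) := by ring_nf
      _ ≤ ENNReal.ofReal c * μ (ball x (2 ^ n * r)) := hc _ _ (by positivity)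
      _ ≤ ENNReal.ofReal c * (ENNReal.ofReal c ^ n * μ (ball x r)) := by gcongr; exact ih x r hr
      _ = _ := by ring

theorem sigmaFinite [Nonempty X] (hμ : IsDoublingMeasure μ) : SigmaFinite μ := by
  obtain ⟨x₀⟩ := ‹Nonempty X›
  refine ⟨⟨⟨fun n : ℕ => ball x₀ (n + 1), fun _ => trivial,
    fun n => hμ.ball_lt_top _ _ (by positivity), ?_⟩⟩⟩
  refine eq_univ_of_forall fun x => mem_iUnion.2 ?_
  obtain ⟨n, hn⟩ := exists_nat_gt (dist x x₀)
  exact ⟨n, by rw [mem_ball]; linarith⟩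

/-- A maximal `ε`-separated set is countable: its `ε/2`-balls are disjoint and have positive measure
for a σ-finite `μ`. Joint measurability in the Tonelli argument needs this. -/
theorem secondCountableTopology [Nonempty X] [OpensMeasurableSpace X]
    (hμ : IsDoublingMeasure μ) : SecondCountableTopology X := by
  have := hμ.sigmaFinite
  refine Metric.secondCountable_of_almost_dense_set fun ε hε => ?_
  obtain ⟨s, hs, hmax⟩ : ∃ s : Set X, s.Pairwise (fun x y => ε ≤ dist x y) ∧
      ∀ x, ∃ y ∈ s, dist x y ≤ ε := by
    obtain ⟨s, hs⟩ := zorn_subset {s : Set X | s.Pairwise (fun x y => ε ≤ dist x y)} (by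
      intro c hc hchain
      refine ⟨⋃₀ c, ?_, fun t ht => subset_sUnion_of_mem ht⟩
      exact (pairwise_sUnion hchain.directedOn).2 hc)
    refine ⟨s, hs.prop, fun x => ?_⟩
    by_contra! hx
    have hins : insert x s ∈ {s : Set X | s.Pairwise (fun x y => ε ≤ dist x y)} := by
      refine hs.prop.insert fun y hy _ => ⟨(hx y hy).le, ?_⟩
      rw [dist_comm]; exact (hx y hy).le
    have hxs : x ∈ s := hs.le_of_ge hins (subset_insert _ _) (mem_insert _ _)
    have := hx x hxs
    rw [dist_self] at this
    exact this.not_gt hε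
  refine ⟨s, ?_, hmax⟩
  have hcount := Measure.countable_meas_pos_of_disjoint_iUnion (μ := μ)
    (As := fun x : s => ball (x : X) (ε / 2)) (fun _ => measurableSet_ball) (by
      intro x y hxy
      refine ball_disjoint_ball ?_
      have := hs x.2 y.2 (Subtype.coe_injective.ne hxy)
      linarith)
  have : {x : s | 0 < μ (ball (x : X) (ε / 2))} = univ :=
    eq_univ_of_forall fun x => hμ.ball_pos _ _ (by positivity)
  rw [this] at hcount
  exact countable_coe_iff.1 (countable_univ_iff.1 hcount)

/-- A discrete Hardy-type bound: the kernel `g(x)^{-η} / μ(B(x, 4 g(x)))`, integrated over the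
points `x` seen from `y`, is comparable to `g(y)^{-η}`. -/
theorem lintegral_kernel_le [OpensMeasurableSpace X] (hμ : IsDoublingMeasure μ)
    {η : ℝ} (hη : 0 < η) :
    ∃ C : ℝ≥0∞, C ≠ ∞ ∧ ∀ g : X → ℝ, LipschitzWith 1 g → ∀ y, 0 < g y →
      ∫⁻ x in {x | dist x y < 4 * g x},
        ENNReal.ofReal (g x) ^ (-η) / μ (ball x (4 * g x)) ∂μ ≤
          C * ENNReal.ofReal (g y) ^ (-η) := by
  obtain ⟨c, hc, hcμ⟩ := hμ.exists_pow_bound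
  have h2 : ENNReal.ofReal (2 ^ (-η)) < 1 := by
    rw [ENNReal.ofReal_lt_one]
    exact Real.rpow_lt_one_of_one_lt_of_neg one_lt_two (by linarith)
  refine ⟨c ^ 2 * (ENNReal.ofReal (5 ^ η) * (1 - ENNReal.ofReal (2 ^ (-η)))⁻¹), ?_, ?_⟩
  · refine ENNReal.mul_ne_top (ENNReal.pow_ne_top hc)
      (ENNReal.mul_ne_top ENNReal.ofReal_ne_top (ENNReal.inv_ne_top.2 ?_))
    exact (tsub_pos_of_lt h2).ne'
  intro g hg y hy
  -- The layers start at `g y / 5` because `g y ≤ g x + dist x y < 5 * g x` on the domain of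
  -- integration.
  set τ : ℕ → ℝ := fun k => 2 ^ k * (g y / 5) with hτ
  have hτpos : ∀ k, 0 < τ k := fun k => by positivity
  set S : ℕ → Set X := fun k => {x | dist x y < 4 * g x ∧ τ k ≤ g x ∧ g x < 2 * τ k} with hS
  have hcover : {x | dist x y < 4 * g x} ⊆ ⋃ k, S k := by
    intro x hx
    rw [mem_ofPred_eq] at hx
    have h1 : g y ≤ g x + dist x y := by
      have := hg.dist_le_mul y x
      rw [NNReal.coe_one, one_mul, Real.dist_eq, dist_comm] at this
      linarith [(abs_le.1 this).2]
    obtain ⟨k, hk1, hk2⟩ := exists_nat_pow_near (x := g x / (g y / 5)) (y := (2 : ℝ))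
      (by rw [le_div_iff₀ (by positivity)]; linarith) one_lt_two
    rw [le_div_iff₀ (by positivity)] at hk1
    rw [div_lt_iff₀ (by positivity), pow_succ] at hk2
    refine mem_iUnion.2 ⟨k, hx, hk1, ?_⟩
    simp only [hτ]; linarith
  -- The layer lies in `ball y (8 * τ k)`, whose measure is at most `c ^ 2` times that of each `ball
  -- x (4 * g x)`; the two measures cancel.
  have hlayer : ∀ k, ∫⁻ x in S k, ENNReal.ofReal (g x) ^ (-η) / μ (ball x (4 * g x)) ∂μ ≤
      c ^ 2 * ENNReal.ofReal (τ k) ^ (-η) := by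
    intro k
    have hpos := hμ.ball_pos y (8 * τ k) (by have := hτpos k; positivity)
    have hfin := hμ.ball_lt_top y (8 * τ k) (by have := hτpos k; positivity)
    have hbound : ∀ x ∈ S k, ENNReal.ofReal (g x) ^ (-η) / μ (ball x (4 * g x)) ≤
        c ^ 2 * ENNReal.ofReal (τ k) ^ (-η) / μ (ball y (8 * τ k)) := by
      rintro x ⟨hx1, hx2, hx3⟩
      have hμx : μ (ball y (8 * τ k)) ≤ c ^ 2 * μ (ball x (4 * g x)) := calc
        μ (ball y (8 * τ k)) ≤ μ (ball x (2 ^ 2 * (4 * τ k))) := by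
          refine measure_mono (ball_subset_ball' ?_)
          rw [dist_comm]; linarith
        _ ≤ c ^ 2 * μ (ball x (4 * τ k)) := hcμ _ _ _ (by have := hτpos k; positivity)
        _ ≤ c ^ 2 * μ (ball x (4 * g x)) := by gcongr
      have hmono : ENNReal.ofReal (g x) ^ (-η) ≤ ENNReal.ofReal (τ k) ^ (-η) := by
        rw [ENNReal.rpow_neg, ENNReal.rpow_neg]
        gcongr
      calc ENNReal.ofReal (g x) ^ (-η) / μ (ball x (4 * g x))
          ≤ ENNReal.ofReal (τ k) ^ (-η) * (c ^ 2 * (μ (ball y (8 * τ k)))⁻¹) :=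
            mul_le_mul' hmono (ENNReal.inv_le_mul_inv_of_le_mul hμx hpos.ne' hfin.ne)
        _ = _ := by rw [div_eq_mul_inv]; ring
    calc ∫⁻ x in S k, ENNReal.ofReal (g x) ^ (-η) / μ (ball x (4 * g x)) ∂μ
        ≤ ∫⁻ x in S k, c ^ 2 * ENNReal.ofReal (τ k) ^ (-η) / μ (ball y (8 * τ k)) ∂μ := by
          refine setLIntegral_mono measurable_const hbound
      _ ≤ c ^ 2 * ENNReal.ofReal (τ k) ^ (-η) / μ (ball y (8 * τ k)) * μ (ball y (8 * τ k)) := by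
          rw [setLIntegral_const]
          gcongr
          rintro x ⟨hx1, hx2, hx3⟩
          rw [mem_ball]; linarith
      _ = _ := ENNReal.div_mul_cancel hpos.ne' hfin.ne
  have hτη : ∀ k, ENNReal.ofReal (τ k) ^ (-η) =
      ENNReal.ofReal (5 ^ η) * ENNReal.ofReal (g y) ^ (-η) * ENNReal.ofReal (2 ^ (-η)) ^ k := by
    intro k
    rw [ENNReal.ofReal_rpow_of_pos (hτpos k), ENNReal.ofReal_rpow_of_pos hy,
      ← ENNReal.ofReal_pow (by positivity), ← ENNReal.ofReal_mul (by positivity),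
      ← ENNReal.ofReal_mul (by positivity)]
    congr 1
    simp only [hτ]
    rw [Real.mul_rpow (by positivity) (by positivity), Real.div_rpow hy.le (by norm_num),
      ← Real.rpow_natCast, ← Real.rpow_natCast, ← Real.rpow_mul (by norm_num),
      ← Real.rpow_mul (by norm_num), Real.rpow_neg (by norm_num : (0 : ℝ) ≤ 5), div_inv_eq_mul,
      mul_comm (k : ℝ)]
    ring
  calc ∫⁻ x in {x | dist x y < 4 * g x}, ENNReal.ofReal (g x) ^ (-η) / μ (ball x (4 * g x)) ∂μ
      ≤ ∫⁻ x in ⋃ k, S k, ENNReal.ofReal (g x) ^ (-η) / μ (ball x (4 * g x)) ∂μ :=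
        lintegral_mono_set hcover
    _ ≤ ∑' k, ∫⁻ x in S k, ENNReal.ofReal (g x) ^ (-η) / μ (ball x (4 * g x)) ∂μ :=
        lintegral_iUnion_le _ _
    _ ≤ ∑' k, c ^ 2 * ENNReal.ofReal (τ k) ^ (-η) := ENNReal.tsum_le_tsum hlayer
    _ = _ := by
        simp_rw [hτη]
        rw [ENNReal.tsum_mul_left, ENNReal.tsum_mul_left, ENNReal.tsum_geometric]
        ring

end IsDoublingMeasure

/-! ### Geometry of the truncation -/

section Truncation

variable {X : Type*} [MetricSpace X] {E : Set X} {z : X} {r : ℝ}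

theorem truncationStep_subset (j : ℕ) : truncationStep E z r j ⊆ E := by
  cases j with
  | zero => exact inter_subset_left
  | succ j => exact iUnion₂_subset fun _ _ => inter_subset_left

theorem truncation_subset (hE : IsClosed E) : truncation E z r ⊆ E :=
  closure_minimal (iUnion_subset truncationStep_subset) hE

theorem truncationStep_subset_truncation (j : ℕ) : truncationStep E z r j ⊆ truncation E z r :=
  (subset_iUnion _ j).trans subset_closure

theorem mem_truncationStep_zero (hz : z ∈ E) (hr : 0 < r) : z ∈ truncationStep E z r 0 :=
  ⟨hz, subset_closure (mem_ball_self (by positivity))⟩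

/-- Generation `l` is within `r / 2 ^ (l + 1)` of its parent; the bound is the geometric sum of
these steps. -/
theorem exists_ancestor_truncationStep (i k : ℕ) {x : X} (hx : x ∈ truncationStep E z r (i + k)) :
    ∃ w ∈ truncationStep E z r i, dist x w ≤ r / 2 ^ (i + 1) - r / 2 ^ (i + k + 1) := by
  induction k generalizing x with
  | zero => exact ⟨x, hx, by simp⟩
  | succ k ih =>
    obtain ⟨y, hy, -, hxy⟩ := mem_iUnion₂.1 (show x ∈ ⋃ y ∈ truncationStep E z r (i + k),
      E ∩ closure (ball y (r / 2 ^ (i + k + 2))) from hx)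
    obtain ⟨w, hw, hyw⟩ := ih hy
    have hxy' : dist x y ≤ r / 2 ^ (i + k + 2) := closure_ball_subset_closedBall hxy
    refine ⟨w, hw, (dist_triangle x y w).trans ?_⟩
    have h1 : r / 2 ^ (i + k + 1) = 2 * (r / 2 ^ (i + k + 2)) := by
      rw [pow_succ _ (i + k + 1)]; field_simp
    have h2 : i + (k + 1) + 1 = i + k + 2 := by ring
    rw [h2]
    linarith

theorem dist_le_of_mem_truncationStep (hr : 0 < r) {j : ℕ} {x : X}
    (hx : x ∈ truncationStep E z r j) : dist x z ≤ r := by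
  rw [← zero_add j] at hx
  obtain ⟨w, hw, hxw⟩ := exists_ancestor_truncationStep 0 j hx
  have hwz : dist w z ≤ r / 2 := closure_ball_subset_closedBall hw.2
  have : 0 < r / 2 ^ (0 + j + 1) := by positivity
  have h3 : r / 2 ^ (0 + 1) = r / 2 := by simp
  linarith [dist_triangle x w z]

theorem inter_ball_subset_truncation {j : ℕ} {x : X} (hx : x ∈ truncationStep E z r j) :
    E ∩ ball x (r / 2 ^ (j + 2)) ⊆ truncation E z r := by
  refine Subset.trans ?_ (truncationStep_subset_truncation (j + 1))
  intro y hy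
  exact mem_iUnion₂.2 ⟨x, hx, hy.1, subset_closure hy.2⟩

/-- Near every point of the truncation and at every scale `ρ ≤ r`, there is a ball of radius
`ρ / 4` in which the truncation contains all of `E`. -/
theorem exists_inter_ball_subset_truncation {j : ℕ} {x : X} (hx : x ∈ truncationStep E z r j)
    {ρ : ℝ} (hρ : 0 < ρ) (hρr : ρ ≤ r) :
    ∃ k, ∃ w ∈ truncationStep E z r k, dist x w < ρ ∧ E ∩ ball w (ρ / 4) ⊆ truncation E z r := by
  -- Generation `i` matches scale `ρ`: descendants stray less than `r / 2 ^ (i + 1) < ρ`, while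
  -- every generation up to `i` keeps all of `E` within `ρ / 4` of its points. So a late `x` is
  -- replaced by its ancestor, and an early one serves itself.
  obtain ⟨i, hi1, hi2⟩ := exists_nat_pow_near (x := r / ρ) (y := (2 : ℝ))
    (by rwa [le_div_iff₀ hρ, one_mul]) one_lt_two
  rw [le_div_iff₀ hρ] at hi1
  rw [div_lt_iff₀ hρ] at hi2
  have hr : 0 < r := hρ.trans_le hρr
  have key : ∀ l ≤ i, ρ / 4 ≤ r / 2 ^ (l + 2) := by
    intro l hl
    have hpow : (2 : ℝ) ^ l ≤ 2 ^ i := pow_le_pow_right₀ one_le_two hl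
    rw [le_div_iff₀ (by positivity), pow_add]
    nlinarith
  rcases le_total i j with hij | hij
  · obtain ⟨k, rfl⟩ := Nat.exists_eq_add_of_le hij
    obtain ⟨w, hw, hxw⟩ := exists_ancestor_truncationStep i k hx
    refine ⟨i, w, hw, ?_, ?_⟩
    · have h1 : r / 2 ^ (i + 1) < ρ := by
        rw [div_lt_iff₀ (by positivity)]; linarith
      have h2 : 0 < r / 2 ^ (i + k + 1) := by positivity
      linarith
    · exact (inter_subset_inter_right _ (ball_subset_ball (key i le_rfl))).trans
        (inter_ball_subset_truncation hw)
  · exact ⟨j, x, hx, by rwa [dist_self],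
      (inter_subset_inter_right _ (ball_subset_ball (key j hij))).trans
        (inter_ball_subset_truncation hx)⟩

end Truncation

/-- Almost nearest points of `E` to `y` lie within `R` of `y`, hence within `2 * R` of `w`, where
`E` is contained in `F`. -/
theorem infEDist_eq_of_inter_ball_subset {X : Type*} [MetricSpace X] {E F : Set X} {w y : X}
    {R : ℝ} (hFE : F ⊆ E) (hw : w ∈ E) (hsub : E ∩ ball w (2 * R) ⊆ F) (hy : y ∈ ball w R) :
    infEDist y E = infEDist y F := by
  refine le_antisymm (infEDist_anti hFE) ?_
  have hR : 0 < R := dist_nonneg.trans_lt hy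
  refine le_of_forall_gt fun b hb => ?_
  have hyE : infEDist y E < ENNReal.ofReal R := (infEDist_le_edist_of_mem hw).trans_lt
    (by rw [edist_dist]; exact (ENNReal.ofReal_lt_ofReal_iff hR).2 hy)
  obtain ⟨e, he, hye⟩ := infEDist_lt_iff.1 (lt_min hb hyE)
  rw [lt_min_iff] at hye
  refine (infEDist_le_edist_of_mem (hsub ⟨he, ?_⟩)).trans_lt hye.1
  have h1 : dist y e < R := by
    have := hye.2
    rw [edist_dist] at this
    exact (ENNReal.ofReal_lt_ofReal_iff hR).1 this
  rw [mem_ball] at hy ⊢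
  linarith [dist_triangle e y w, dist_comm e y]

/-! ### Local and pointwise estimates from the Aikawa condition -/

/-- Testing `u` against a weight `ω`. -/
theorem ofReal_abs_rpow_mul_lintegral_le {X : Type*} [MeasurableSpace X] {ν : Measure X}
    {p : ℝ} (hp : 1 ≤ p) {u : X → ℝ} (hu : Measurable u) {ω : X → ℝ≥0∞} (hω : Measurable ω)
    (a : ℝ) :
    ENNReal.ofReal (|a| ^ p) * ∫⁻ y, ω y ∂ν ≤
      2 ^ p * (∫⁻ y, ω y * ENNReal.ofReal (|a - u y| ^ p) ∂ν +
        ∫⁻ y, ω y * ENNReal.ofReal (|u y| ^ p) ∂ν) := by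
  have hp0 : 0 ≤ p := by linarith
  have hpt : ∀ b : ℝ, ENNReal.ofReal (|a| ^ p) ≤
      2 ^ p * (ENNReal.ofReal (|a - b| ^ p) + ENNReal.ofReal (|b| ^ p)) := by
    intro b
    rw [← ENNReal.ofReal_rpow_of_nonneg (abs_nonneg _) hp0,
      ← ENNReal.ofReal_rpow_of_nonneg (abs_nonneg _) hp0,
      ← ENNReal.ofReal_rpow_of_nonneg (abs_nonneg _) hp0]
    calc ENNReal.ofReal |a| ^ p ≤ (ENNReal.ofReal |a - b| + ENNReal.ofReal |b|) ^ p := by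
          rw [← ENNReal.ofReal_add (abs_nonneg _) (abs_nonneg _)]
          gcongr
          simpa using abs_add_le (a - b) b
      _ ≤ 2 ^ (p - 1) * (ENNReal.ofReal |a - b| ^ p + ENNReal.ofReal |b| ^ p) :=
          ENNReal.rpow_add_le_mul_rpow_add_rpow _ _ hp
      _ ≤ _ := by
          gcongr
          · exact one_le_two
          · linarith
  have hm : Measurable fun y => ω y * ENNReal.ofReal (|u y| ^ p) := by fun_prop
  rw [← lintegral_const_mul _ hω, ← lintegral_add_right _ hm,
    ← lintegral_const_mul' _ _ (ENNReal.rpow_ne_top_of_nonneg hp0 (by norm_num))]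
  refine lintegral_mono fun y => ?_
  calc ENNReal.ofReal (|a| ^ p) * ω y
      ≤ 2 ^ p * (ENNReal.ofReal (|a - u y| ^ p) + ENNReal.ofReal (|u y| ^ p)) * ω y := by
        gcongr; exact hpt _
    _ = _ := by ring

/-- The upper Aikawa condition bounds a number `a` on a ball centred at `E` by the oscillation of
`u` around `a` plus a small multiple of the weighted norm of `u`. -/
theorem UpperAikawa.measure_ball_mul_le {X : Type*} [MetricSpace X] [MeasurableSpace X]
    [BorelSpace X] {μ : Measure X} (hμ : IsDoublingMeasure μ) {E : Set X} {α : ℝ}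
    (hE : UpperAikawa μ E α) {p : ℝ} (hp : 1 ≤ p) {ε : ℝ} (hε : 0 < ε) :
    ∃ A : ℝ≥0∞, A ≠ ∞ ∧ ∀ z ∈ E, ∀ R : ℝ, 0 < R → ENNReal.ofReal R < scaleBound E →
      ∀ u : X → ℝ, Measurable u → ∀ a : ℝ,
        μ (ball z R) * ENNReal.ofReal (|a| ^ p) ≤
          A * ∫⁻ y in ball z R, ENNReal.ofReal (|a - u y| ^ p) ∂μ +
          2 ^ p * ENNReal.ofReal ε * ENNReal.ofReal R ^ α *
            ∫⁻ y in ball z R, ENNReal.ofReal (|u y| ^ p) / infEDist y E ^ α ∂μ := by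
  obtain ⟨-, hα, hA⟩ := hE
  obtain ⟨δ, hδ, hA⟩ := hA ε hε
  have hp0 : 0 ≤ p := by linarith
  -- Chosen so that `(t * R) ^ α = ε * δ * R ^ α`, which makes both cases below end in the same
  -- bound.
  set t : ℝ := (ε * δ) ^ α⁻¹ with ht
  have htpos : 0 < t := by positivity
  have htα : t ^ α = ε * δ := Real.rpow_inv_rpow (by positivity) hα.ne'
  have h2p : (2 : ℝ≥0∞) ^ p ≠ ∞ := ENNReal.rpow_ne_top_of_nonneg hp0 (by norm_num)
  refine ⟨2 ^ p * (ENNReal.ofReal δ)⁻¹, ENNReal.mul_ne_top h2p ?_, ?_⟩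
  · simpa using hδ
  intro z hz R hR hRE u hu a
  set e := ENNReal.ofReal ε with he
  set d := ENNReal.ofReal δ with hd
  set ρ := ENNReal.ofReal R ^ α with hρ
  have hd0 : d ≠ 0 := by simpa [hd] using hδ
  have hdt : d ≠ ∞ := ENNReal.ofReal_ne_top
  have he0 : e ≠ 0 := by simpa [he] using hε
  have het : e ≠ ∞ := ENNReal.ofReal_ne_top
  have hρ0 : ρ ≠ 0 := by simp [hρ, ENNReal.rpow_eq_zero_iff, hR]
  have hρt : ρ ≠ ∞ := ENNReal.rpow_ne_top_of_nonneg hα.le ENNReal.ofReal_ne_top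
  have htρ : ENNReal.ofReal (t * R) ^ α = e * d * ρ := by
    rw [ENNReal.ofReal_mul htpos.le, ENNReal.mul_rpow_of_nonneg _ _ hα.le,
      ENNReal.ofReal_rpow_of_pos htpos, htα, ENNReal.ofReal_mul hε.le]
  set K : Set X := {y | ENNReal.ofReal (t * R) ≤ infEDist y E} with hK
  have hKm : MeasurableSet K := measurableSet_le measurable_const measurable_infEDist
  set P := ENNReal.ofReal (|a| ^ p) with hP
  set I₁ := ∫⁻ y in ball z R, ENNReal.ofReal (|a - u y| ^ p) ∂μ with hI₁
  set I₂ := ∫⁻ y in ball z R, ENNReal.ofReal (|u y| ^ p) / infEDist y E ^ α ∂μ with hI₂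
  have hμ0 : μ (ball z R) ≠ 0 := (hμ.ball_pos z R hR).ne'
  have hμt : μ (ball z R) ≠ ∞ := (hμ.ball_lt_top z R hR).ne
  -- If points close to `E` are rare, the Aikawa condition applies to `K`, and its weight is bounded
  -- since `K` stays away from `E`. Otherwise they fill a proportion `δ` of the ball, and there
  -- `dist(·, E) ^ (-α)` is already large, so the indicator of `Kᶜ` serves as weight.
  rcases le_or_gt (μ (ball z R \ K)) (d * μ (ball z R)) with hcase | hcase
  · have hAK := hA z hz R hR hRE K hKm hcase
    rw [setLAverage_eq] at hAK
    set ω : X → ℝ≥0∞ := fun y => K.indicator (1 : X → ℝ≥0∞) y / infEDist y E ^ α with hω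
    have hωm : Measurable ω :=
      (measurable_one.indicator hKm).div (measurable_infEDist.pow_const _)
    have hlow : μ (ball z R) ≤ e * ρ * ∫⁻ y in ball z R, ω y ∂μ := by
      have h1 : ENNReal.ofReal (R ^ (-α) / ε) = (e * ρ)⁻¹ := by
        rw [ENNReal.ofReal_div_of_pos hε, ← ENNReal.ofReal_rpow_of_pos hR, ENNReal.rpow_neg,
          ENNReal.mul_inv (Or.inl he0) (Or.inl het), div_eq_mul_inv, mul_comm]
      rw [h1, ENNReal.le_div_iff_mul_le (Or.inl hμ0) (Or.inl hμt)] at hAK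
      calc μ (ball z R) = e * ρ * ((e * ρ)⁻¹ * μ (ball z R)) := by
            rw [← mul_assoc, ENNReal.mul_inv_cancel (mul_ne_zero he0 hρ0)
              (ENNReal.mul_ne_top het hρt), one_mul]
        _ ≤ _ := by gcongr
    have hω1 : ∀ y, ω y ≤ (e * d * ρ)⁻¹ := by
      intro y
      by_cases hy : y ∈ K
      · have hy' : ENNReal.ofReal (t * R) ≤ infEDist y E := hy
        simp only [hω, indicator_of_mem hy, Pi.one_apply, one_div]
        rw [← htρ]
        gcongr
      · simp [hω, indicator_of_notMem hy]
    have hω2 : ∀ y, ω y ≤ (infEDist y E ^ α)⁻¹ := by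
      intro y
      rw [← one_div]
      refine ENNReal.div_le_div_right ?_ _
      exact indicator_le_self' (fun _ _ => zero_le) y
    have hint1 : ∫⁻ y in ball z R, ω y * ENNReal.ofReal (|a - u y| ^ p) ∂μ ≤
        (e * d * ρ)⁻¹ * I₁ := by
      rw [hI₁, ← lintegral_const_mul _ (by fun_prop)]
      exact lintegral_mono fun y => by gcongr; exact hω1 y
    have hint2 : ∫⁻ y in ball z R, ω y * ENNReal.ofReal (|u y| ^ p) ∂μ ≤ I₂ :=
      lintegral_mono fun y => by
        rw [ENNReal.div_eq_inv_mul]; gcongr; exact hω2 y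
    have hcancel : e * ρ * (e * d * ρ)⁻¹ = d⁻¹ := by
      rw [show e * d * ρ = e * ρ * d by ring, ENNReal.mul_inv (Or.inr hdt) (Or.inr hd0),
        ← mul_assoc, ENNReal.mul_inv_cancel (mul_ne_zero he0 hρ0)
          (ENNReal.mul_ne_top het hρt), one_mul]
    have hmain : P * ∫⁻ y in ball z R, ω y ∂μ ≤ 2 ^ p * ((e * d * ρ)⁻¹ * I₁ + I₂) :=
      (ofReal_abs_rpow_mul_lintegral_le hp hu hωm a).trans
        (mul_le_mul' le_rfl (add_le_add hint1 hint2))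
    calc μ (ball z R) * P ≤ e * ρ * (∫⁻ y in ball z R, ω y ∂μ) * P := by gcongr
      _ = e * ρ * (P * ∫⁻ y in ball z R, ω y ∂μ) := by ring
      _ ≤ e * ρ * (2 ^ p * ((e * d * ρ)⁻¹ * I₁ + I₂)) :=
          mul_le_mul' le_rfl hmain
      _ = 2 ^ p * (e * ρ * (e * d * ρ)⁻¹) * I₁ + 2 ^ p * e * ρ * I₂ := by ring
      _ = _ := by rw [hcancel]
  · set ω : X → ℝ≥0∞ := Kᶜ.indicator 1 with hω
    have hωm : Measurable ω := measurable_one.indicator hKm.compl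
    have hlow : d * μ (ball z R) ≤ ∫⁻ y in ball z R, ω y ∂μ := by
      rw [hω, lintegral_indicator_one hKm.compl, Measure.restrict_apply hKm.compl, inter_comm,
        ← sdiff_eq]
      exact hcase.le
    have hint1 : ∫⁻ y in ball z R, ω y * ENNReal.ofReal (|a - u y| ^ p) ∂μ ≤ I₁ := by
      refine lintegral_mono fun y => mul_le_of_le_one_left zero_le ?_
      exact indicator_le_self' (fun _ _ => zero_le) y
    have hint2 : ∫⁻ y in ball z R, ω y * ENNReal.ofReal (|u y| ^ p) ∂μ ≤ e * d * ρ * I₂ := by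
      have hc0 : e * d * ρ ≠ 0 := mul_ne_zero (mul_ne_zero he0 hd0) hρ0
      have hct : e * d * ρ ≠ ∞ := ENNReal.mul_ne_top (ENNReal.mul_ne_top het hdt) hρt
      rw [hI₂, ← lintegral_const_mul' _ _ hct]
      refine lintegral_mono fun y => ?_
      by_cases hy : y ∈ K
      · simp [hω, hy]
      · have hy' : infEDist y E < ENNReal.ofReal (t * R) := not_le.1 hy
        have hle : infEDist y E ^ α ≤ e * d * ρ := by
          rw [← htρ]; gcongr
        simp only [hω, indicator_of_mem (mem_compl hy), Pi.one_apply, one_mul]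
        calc ENNReal.ofReal (|u y| ^ p)
            = e * d * ρ * (ENNReal.ofReal (|u y| ^ p) / (e * d * ρ)) :=
              (ENNReal.mul_div_cancel hc0 hct).symm
          _ ≤ _ := by gcongr
    have hmain : P * ∫⁻ y in ball z R, ω y ∂μ ≤ 2 ^ p * (I₁ + e * d * ρ * I₂) :=
      (ofReal_abs_rpow_mul_lintegral_le hp hu hωm a).trans
        (mul_le_mul' le_rfl (add_le_add hint1 hint2))
    calc μ (ball z R) * P = d⁻¹ * (P * (d * μ (ball z R))) := by
          rw [mul_left_comm P, ← mul_assoc d⁻¹, ENNReal.inv_mul_cancel hd0 hdt, one_mul, mul_comm]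
      _ ≤ d⁻¹ * (P * ∫⁻ y in ball z R, ω y ∂μ) := by gcongr
      _ ≤ d⁻¹ * (2 ^ p * (I₁ + e * d * ρ * I₂)) :=
          mul_le_mul' le_rfl hmain
      _ = 2 ^ p * d⁻¹ * I₁ + d⁻¹ * d * (2 ^ p * e * ρ * I₂) := by ring
      _ = _ := by rw [ENNReal.inv_mul_cancel hd0 hdt, one_mul]

/-- The pointwise form of the Hardy inequality: `|u(x)|^p / dist(x, F)^{sp}` is bounded by the
energy density at `x` and a small multiple of a kernel applied to `|u|^p / dist(·, F)^α`. -/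
theorem UpperAikawa.pointwise_hardy {X : Type*} [MetricSpace X] [MeasurableSpace X]
    [BorelSpace X] {μ : Measure X} (hμ : IsDoublingMeasure μ) {E : Set X} (hE : IsClosed E)
    {α : ℝ} (hEA : UpperAikawa μ E α) {p : ℝ} (hp : 1 ≤ p) {σ : ℝ} (hσ : 0 < σ) :
    ∃ κ : ℝ≥0∞, κ ≠ ∞ ∧ ∀ ε : ℝ, 0 < ε → ∃ A : ℝ≥0∞, A ≠ ∞ ∧
      ∀ z ∈ E, ∀ r : ℝ, 0 < r → ENNReal.ofReal r < scaleBound E →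
        ∀ u : X → ℝ, Measurable u → (∀ x ∈ truncation E z r, u x = 0) →
          ∀ x ∈ ball z (8 * r) \ truncation E z r,
            ENNReal.ofReal (|u x| ^ p) / infEDist x (truncation E z r) ^ σ ≤
              A * ∫⁻ y in ball z (8 * r), ENNReal.ofReal (|u x - u y| ^ p) /
                (edist x y ^ σ * μ (ball x (dist x y))) ∂μ +
              κ * ENNReal.ofReal ε *
                (ENNReal.ofReal (infDist x (truncation E z r)) ^ (-(σ - α)) /
                  μ (ball x (4 * infDist x (truncation E z r))) *
                ∫⁻ y in ball z (8 * r) \ truncation E z r,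
                  {y | dist x y < 4 * infDist x (truncation E z r)}.indicator
                    (fun y => ENNReal.ofReal (|u y| ^ p) /
                      infEDist y (truncation E z r) ^ α) y ∂μ) := by
  have hp0 : 0 < p := by linarith
  have hα := hEA.2.1
  obtain ⟨c, hc, hcμ⟩ := hμ.exists_pow_bound
  -- `κ` is fixed before `ε`, as absorption requires. The power 9 comes from `2 ^ 9 * R = 8 * D`,
  -- enough for `ball w (2 ^ 9 * R)` to contain `ball x (4 * D)`.
  refine ⟨c ^ 9 * 2 ^ p, ENNReal.mul_ne_top (ENNReal.pow_ne_top hc)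
    (ENNReal.rpow_ne_top_of_nonneg hp0.le (by norm_num)), fun ε hε => ?_⟩
  obtain ⟨A, hA, hAμ⟩ := hEA.measure_ball_mul_le hμ hp hε
  refine ⟨c ^ 9 * A * 4 ^ σ, ENNReal.mul_ne_top (ENNReal.mul_ne_top (ENNReal.pow_ne_top hc) hA)
    (ENNReal.rpow_ne_top_of_nonneg hσ.le (by norm_num)), ?_⟩
  intro z hz r hr hrE u hu hu0 x hx
  have hzF : z ∈ truncation E z r :=
    truncationStep_subset_truncation 0 (mem_truncationStep_zero hz hr)
  set F := truncation E z r with hF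
  have hFne : F.Nonempty := ⟨z, hzF⟩
  have hFc : IsClosed F := isClosed_closure
  set D := infDist x F with hD
  have hDpos : 0 < D := (hFc.notMem_iff_infDist_pos hFne).1 hx.2
  have hDr : D < 8 * r := (infDist_le_dist_of_mem hzF).trans_lt hx.1
  -- The nearby point must belong to some generation, not merely to the closure; closure does not
  -- change the distance.
  obtain ⟨w₀, hw₀, hxw₀⟩ : ∃ w₀ ∈ ⋃ j, truncationStep E z r j, dist x w₀ < 2 * D := by
    rw [← infDist_lt_iff (closure_nonempty_iff.1 hFne), ← infDist_closure]
    change D < 2 * D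
    linarith
  obtain ⟨j, hw₀⟩ := mem_iUnion.1 hw₀
  obtain ⟨k, w, hw, hw₀w, hsub⟩ := exists_inter_ball_subset_truncation hw₀
    -- The scale `D / 8` is admissible because `D < 8 * r`, and `2 * R` is then exactly a quarter of
    -- it.
    (ρ := D / 8) (by positivity) (by linarith)
  have hwE : w ∈ E := truncationStep_subset k hw
  set R := D / 64 with hR
  have hRpos : 0 < R := by positivity
  have hxw : dist x w < 2 * D + D / 8 := by linarith [dist_triangle x w₀ w]
  have hwz : dist w z ≤ r := dist_le_of_mem_truncationStep hr hw
  have hsub' : E ∩ ball w (2 * R) ⊆ F := by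
    rwa [show 2 * R = D / 8 / 4 by rw [hR]; ring]
  have hball1 : ∀ y ∈ ball w R, dist x y < 4 * D := fun y hy => by
    rw [mem_ball, dist_comm] at hy
    linarith [dist_triangle x w y]
  have hball2 : ball w R ⊆ ball z (8 * r) := ball_subset_ball' (by linarith)
  have key := hAμ w hwE R hRpos
    (lt_of_le_of_lt (ENNReal.ofReal_le_ofReal (by linarith)) hrE) u hu (u x)
  set m := μ (ball x (4 * D)) with hm
  have hm0 : m ≠ 0 := (hμ.ball_pos x _ (by positivity)).ne'
  have hmt : m ≠ ∞ := (hμ.ball_lt_top x _ (by positivity)).ne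
  have hmw : m ≤ c ^ 9 * μ (ball w R) := by
    refine le_trans (measure_mono (ball_subset_ball' ?_)) (hcμ 9 w R hRpos)
    linarith
  set P := ENNReal.ofReal (|u x| ^ p) with hP
  set Δ := ENNReal.ofReal D with hΔ
  have hΔ0 : Δ ≠ 0 := by simpa [hΔ] using hDpos
  have hΔt : Δ ≠ ∞ := ENNReal.ofReal_ne_top
  have hinf : infEDist x F = Δ := (ENNReal.ofReal_toReal (infEDist_ne_top hFne)).symm
  have hΔσ0 : Δ ^ σ ≠ 0 := by simp [ENNReal.rpow_eq_zero_iff, hΔ0, hΔt]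
  have hΔσt : Δ ^ σ ≠ ∞ := ENNReal.rpow_ne_top_of_nonneg hσ.le hΔt
  set Q := ∫⁻ y in ball z (8 * r), ENNReal.ofReal (|u x - u y| ^ p) /
    (edist x y ^ σ * μ (ball x (dist x y))) ∂μ with hQ
  set J := ∫⁻ y in ball z (8 * r) \ F, {y | dist x y < 4 * D}.indicator
    (fun y => ENNReal.ofReal (|u y| ^ p) / infEDist y F ^ α) y ∂μ with hJ
  have hI₁ : ∫⁻ y in ball w R, ENNReal.ofReal (|u x - u y| ^ p) ∂μ ≤ 4 ^ σ * Δ ^ σ * m * Q := by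
    have h4t : (4 : ℝ≥0∞) ^ σ ≠ ∞ := ENNReal.rpow_ne_top_of_nonneg hσ.le (by norm_num)
    have h40 : (4 : ℝ≥0∞) ^ σ ≠ 0 := by simp [ENNReal.rpow_eq_zero_iff]
    have hV0 : 4 ^ σ * Δ ^ σ * m ≠ 0 := mul_ne_zero (mul_ne_zero h40 hΔσ0) hm0
    have hVt : 4 ^ σ * Δ ^ σ * m ≠ ∞ := ENNReal.mul_ne_top (ENNReal.mul_ne_top h4t hΔσt) hmt
    calc ∫⁻ y in ball w R, ENNReal.ofReal (|u x - u y| ^ p) ∂μ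
        ≤ ∫⁻ y in ball w R, 4 ^ σ * Δ ^ σ * m * (ENNReal.ofReal (|u x - u y| ^ p) /
            (edist x y ^ σ * μ (ball x (dist x y)))) ∂μ := by
          refine setLIntegral_mono' measurableSet_ball fun y hy => ?_
          have hd : edist x y ^ σ * μ (ball x (dist x y)) ≤ 4 ^ σ * Δ ^ σ * m := by
            have h1 : edist x y ≤ 4 * Δ := by
              rw [edist_dist, hΔ, ← ENNReal.ofReal_ofNat, ← ENNReal.ofReal_mul (by norm_num)]
              exact ENNReal.ofReal_le_ofReal (hball1 y hy).le
            rw [← ENNReal.mul_rpow_of_nonneg _ _ hσ.le]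
            exact mul_le_mul' (ENNReal.rpow_le_rpow h1 hσ.le)
              (measure_mono (ball_subset_ball (hball1 y hy).le))
          calc ENNReal.ofReal (|u x - u y| ^ p)
              = 4 ^ σ * Δ ^ σ * m * (ENNReal.ofReal (|u x - u y| ^ p) / (4 ^ σ * Δ ^ σ * m)) :=
                (ENNReal.mul_div_cancel hV0 hVt).symm
            _ ≤ _ := mul_le_mul' le_rfl (ENNReal.div_le_div_left hd _)
      _ = 4 ^ σ * Δ ^ σ * m * ∫⁻ y in ball w R, ENNReal.ofReal (|u x - u y| ^ p) /
            (edist x y ^ σ * μ (ball x (dist x y))) ∂μ := lintegral_const_mul' _ _ hVt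
      _ ≤ _ := mul_le_mul' le_rfl (lintegral_mono_set hball2)
  have hI₂ : ∫⁻ y in ball w R, ENNReal.ofReal (|u y| ^ p) / infEDist y E ^ α ∂μ ≤ J := by
    rw [hJ, ← lintegral_indicator measurableSet_ball,
      ← lintegral_indicator (measurableSet_ball.diff hFc.measurableSet)]
    refine lintegral_mono fun y => ?_
    by_cases hy : y ∈ ball w R
    · rw [indicator_of_mem hy,
        infEDist_eq_of_inter_ball_subset (truncation_subset hE) hwE hsub' hy]
      by_cases hyF : y ∈ F
      -- On `F` the numerator vanishes, and `0 / 0 = 0` in `ℝ≥0∞`.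
      · simp [hu0 y hyF, Real.zero_rpow hp0.ne']
      · rw [indicator_of_mem (show y ∈ ball z (8 * r) \ F from ⟨hball2 hy, hyF⟩),
          indicator_of_mem (show y ∈ {y | dist x y < 4 * D} from hball1 y hy)]
    · rw [indicator_of_notMem hy]
      exact zero_le
  have hRα : ENNReal.ofReal R ^ α ≤ Δ ^ α :=
    ENNReal.rpow_le_rpow (ENNReal.ofReal_le_ofReal (by linarith)) hα.le
  have hΔα : (Δ ^ σ)⁻¹ * Δ ^ α = Δ ^ (-(σ - α)) := by
    rw [← ENNReal.rpow_neg, ← ENNReal.rpow_add _ _ hΔ0 hΔt]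
    congr 1; ring
  rw [hinf]
  calc P / Δ ^ σ = m⁻¹ * (Δ ^ σ)⁻¹ * (m * P) := by
        rw [show m⁻¹ * (Δ ^ σ)⁻¹ * (m * P) = m⁻¹ * m * (P * (Δ ^ σ)⁻¹) by ring,
          ENNReal.inv_mul_cancel hm0 hmt, one_mul, div_eq_mul_inv]
    _ ≤ m⁻¹ * (Δ ^ σ)⁻¹ * (c ^ 9 * (μ (ball w R) * P)) := by
        rw [← mul_assoc (c ^ 9)]; gcongr
    _ ≤ m⁻¹ * (Δ ^ σ)⁻¹ * (c ^ 9 * (A * (4 ^ σ * Δ ^ σ * m * Q) +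
          2 ^ p * ENNReal.ofReal ε * Δ ^ α * J)) := by
        refine mul_le_mul' le_rfl (mul_le_mul' le_rfl (key.trans (add_le_add ?_ ?_)))
        · exact mul_le_mul' le_rfl hI₁
        · exact mul_le_mul' (mul_le_mul' le_rfl hRα) hI₂
    _ = m⁻¹ * m * ((Δ ^ σ)⁻¹ * Δ ^ σ) * (c ^ 9 * A * 4 ^ σ * Q) +
          c ^ 9 * 2 ^ p * ENNReal.ofReal ε * ((Δ ^ σ)⁻¹ * Δ ^ α * m⁻¹ * J) := by ring
    _ = _ := by
        rw [ENNReal.inv_mul_cancel hm0 hmt, ENNReal.inv_mul_cancel hΔσ0 hΔσt, hΔα, one_mul,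
          one_mul, div_eq_mul_inv]

/-! ### Boundedness of the kernel operator -/

/-- The kernel operator with weight `infDist x F ^ (-(σ - α)) / μ (ball x (4 * infDist x F))`
is bounded between the weighted spaces of the Hardy inequality. -/
theorem IsDoublingMeasure.lintegral_kernel_operator_le {X : Type*} [MetricSpace X] [Nonempty X]
    [MeasurableSpace X] [BorelSpace X] {μ : Measure X} (hμ : IsDoublingMeasure μ)
    {α σ : ℝ} (hασ : α < σ) :
    ∃ C : ℝ≥0∞, C ≠ ∞ ∧ ∀ (F Ω : Set X), IsClosed F → F.Nonempty → MeasurableSet Ω →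
      Disjoint Ω F → ∀ φ : X → ℝ≥0∞, Measurable φ →
      (Measurable fun x => ENNReal.ofReal (infDist x F) ^ (-(σ - α)) /
        μ (ball x (4 * infDist x F)) * ∫⁻ y in Ω,
          {y | dist x y < 4 * infDist x F}.indicator (fun y => φ y / infEDist y F ^ α) y ∂μ) ∧
      ∫⁻ x in Ω, ENNReal.ofReal (infDist x F) ^ (-(σ - α)) / μ (ball x (4 * infDist x F)) *
        ∫⁻ y in Ω, {y | dist x y < 4 * infDist x F}.indicator
          (fun y => φ y / infEDist y F ^ α) y ∂μ ∂μ ≤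
      C * ∫⁻ y in Ω, φ y / infEDist y F ^ σ ∂μ := by
  have := hμ.sigmaFinite
  have := hμ.secondCountableTopology
  obtain ⟨C, hC, hCμ⟩ := hμ.lintegral_kernel_le (η := σ - α) (by linarith)
  refine ⟨C, hC, fun F Ω hF hFne hΩ hdisj φ hφ => ?_⟩
  have hS : MeasurableSet {q : X × X | dist q.1 q.2 < 4 * infDist q.1 F} :=
    (isOpen_lt continuous_dist (continuous_const.mul
      ((continuous_infDist_pt F).comp continuous_fst))).measurableSet
  set ψ : X → ℝ≥0∞ := fun y => φ y / infEDist y F ^ α with hψ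
  have hψm : Measurable ψ := hφ.div (measurable_infEDist.pow_const _)
  set W : X → ℝ≥0∞ := fun x => ENNReal.ofReal (infDist x F) ^ (-(σ - α)) /
    μ (ball x (4 * infDist x F)) with hW
  have hWm : Measurable W := by
    refine Measurable.div (measurable_infDist.ennreal_ofReal.pow_const _) ?_
    have hball : (fun x => μ (ball x (4 * infDist x F))) =
        fun x => μ (Prod.mk x ⁻¹' {q : X × X | dist q.1 q.2 < 4 * infDist q.1 F}) := by
      funext x
      congr 1
      ext y
      simp [mem_ball, dist_comm]
    rw [hball]
    exact measurable_measure_prodMk_left hS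
  set Φ : X × X → ℝ≥0∞ := {q : X × X | dist q.1 q.2 < 4 * infDist q.1 F}.indicator
    (fun q => ψ q.2) with hΦ
  have hΦm : Measurable Φ := (hψm.comp measurable_snd).indicator hS
  have hΦeq : ∀ x y, {y | dist x y < 4 * infDist x F}.indicator ψ y = Φ (x, y) := fun x y => rfl
  simp_rw [hΦeq]
  refine ⟨hWm.mul hΦm.lintegral_prod_right', ?_⟩
  calc ∫⁻ x in Ω, W x * ∫⁻ y in Ω, Φ (x, y) ∂μ ∂μ
      = ∫⁻ x in Ω, ∫⁻ y in Ω, W x * Φ (x, y) ∂μ ∂μ := by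
        exact lintegral_congr fun x =>
          (lintegral_const_mul _ (hΦm.comp measurable_prodMk_left)).symm
    _ = ∫⁻ y in Ω, ∫⁻ x in Ω, W x * Φ (x, y) ∂μ ∂μ :=
        lintegral_lintegral_swap ((hWm.comp measurable_fst).mul hΦm).aemeasurable
    -- With `y` fixed, the weight integrates to the missing power `σ - α` of `dist(y, F)`.
    _ ≤ ∫⁻ y in Ω, C * (φ y / infEDist y F ^ σ) ∂μ := by
        refine setLIntegral_mono' hΩ fun y hy => ?_
        have hy0 : 0 < infDist y F :=
          (hF.notMem_iff_infDist_pos hFne).1 (hdisj.notMem_of_mem_left hy)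
        have hinf : infEDist y F = ENNReal.ofReal (infDist y F) :=
          (ENNReal.ofReal_toReal (infEDist_ne_top hFne)).symm
        have hd0 : ENNReal.ofReal (infDist y F) ≠ 0 := by simpa using hy0
        calc ∫⁻ x in Ω, W x * Φ (x, y) ∂μ ≤ ∫⁻ x, W x * Φ (x, y) ∂μ := setLIntegral_le_lintegral _ _
          _ = ∫⁻ x, ψ y * {x | dist x y < 4 * infDist x F}.indicator W x ∂μ := by
              refine lintegral_congr fun x => ?_
              rw [← hΦeq]
              by_cases hxy : dist x y < 4 * infDist x F
              · rw [indicator_of_mem (by exact hxy), indicator_of_mem (by exact hxy), mul_comm]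
              · rw [indicator_of_notMem (by exact hxy), indicator_of_notMem (by exact hxy),
                  mul_zero, mul_zero]
          _ = ψ y * ∫⁻ x in {x | dist x y < 4 * infDist x F}, W x ∂μ := by
              have hSy : MeasurableSet {x | dist x y < 4 * infDist x F} :=
                measurable_prodMk_right hS
              rw [lintegral_const_mul _ (hWm.indicator hSy), lintegral_indicator hSy]
          _ ≤ ψ y * (C * ENNReal.ofReal (infDist y F) ^ (-(σ - α))) :=
              mul_le_mul' le_rfl (hCμ _ (lipschitz_infDist_pt F) y hy0)
          _ = C * (φ y / infEDist y F ^ σ) := by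
              simp only [hψ, hinf]
              rw [div_eq_mul_inv, div_eq_mul_inv, ← ENNReal.rpow_neg, ← ENNReal.rpow_neg,
                show -σ = -α + -(σ - α) by ring, ENNReal.rpow_add _ _ hd0 ENNReal.ofReal_ne_top]
              ring
    _ = _ := lintegral_const_mul' _ _ hC

/-! ### Finiteness and absorption -/

/-- For a Lipschitz function vanishing on `F`, the left-hand side of the fractional Hardy
inequality over a bounded set is finite. -/
theorem lintegral_abs_rpow_div_infEDist_lt_top {X : Type*} [MetricSpace X] [MeasurableSpace X]
    {μ : Measure X} {F Ω : Set X} (hF : IsClosed F) (hFne : F.Nonempty) (hΩ : MeasurableSet Ω)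
    (hdisj : Disjoint Ω F) (hμΩ : μ Ω ≠ ∞) {d : ℝ} (hd : ∀ x ∈ Ω, infDist x F ≤ d) {u : X → ℝ}
    {L : ℝ≥0} (hu : LipschitzWith L u) (hu0 : ∀ x ∈ F, u x = 0) {p σ : ℝ} (hp : 0 ≤ p)
    (hσp : σ ≤ p) :
    ∫⁻ x in Ω, ENNReal.ofReal (|u x| ^ p) / infEDist x F ^ σ ∂μ < ∞ := by
  calc ∫⁻ x in Ω, ENNReal.ofReal (|u x| ^ p) / infEDist x F ^ σ ∂μ
      ≤ ∫⁻ _ in Ω, ENNReal.ofReal ((2 * L) ^ p * d ^ (p - σ)) ∂μ := by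
        refine setLIntegral_mono' hΩ fun x hx => ?_
        have hx0 : 0 < infDist x F :=
          (hF.notMem_iff_infDist_pos hFne).1 (hdisj.notMem_of_mem_left hx)
        have hinf : infEDist x F = ENNReal.ofReal (infDist x F) :=
          (ENNReal.ofReal_toReal (infEDist_ne_top hFne)).symm
        -- The factor 2 replaces a nearest point, which need not exist.
        obtain ⟨y, hy, hxy⟩ := (infDist_lt_iff hFne (r := 2 * infDist x F)).1 (by linarith)
        have hux : |u x| ≤ 2 * L * infDist x F := by
          have h1 := hu.dist_le_mul x y
          rw [hu0 y hy, Real.dist_eq, sub_zero] at h1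
          have h2 := mul_le_mul_of_nonneg_left hxy.le L.coe_nonneg
          linarith
        rw [hinf, ENNReal.ofReal_rpow_of_pos hx0, ← ENNReal.ofReal_div_of_pos (by positivity)]
        refine ENNReal.ofReal_le_ofReal ?_
        rw [div_le_iff₀ (by positivity)]
        calc |u x| ^ p ≤ (2 * L * infDist x F) ^ p := by gcongr
          _ = (2 * L) ^ p * infDist x F ^ (p - σ) * infDist x F ^ σ := by
              rw [Real.mul_rpow (by positivity) hx0.le, mul_assoc, ← Real.rpow_add hx0]
              congr 2; ring
          _ ≤ (2 * L) ^ p * d ^ (p - σ) * infDist x F ^ σ := by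
              gcongr
              exact hd x hx
    _ = ENNReal.ofReal ((2 * L) ^ p * d ^ (p - σ)) * μ Ω := setLIntegral_const _ _
    _ < ∞ := ENNReal.mul_lt_top ENNReal.ofReal_lt_top hμΩ.lt_top

theorem ENNReal.exists_mul_ofReal_le_half {M : ℝ≥0∞} (hM : M ≠ ∞) :
    ∃ ε : ℝ, 0 < ε ∧ M * ENNReal.ofReal ε ≤ 2⁻¹ := by
  refine ⟨1 / (2 * (M.toReal + 1)), by positivity, ?_⟩
  have hM' : 0 ≤ M.toReal := ENNReal.toReal_nonneg
  suffices ENNReal.ofReal M.toReal * ENNReal.ofReal (1 / (2 * (M.toReal + 1))) ≤ 2⁻¹ by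
    rwa [ENNReal.ofReal_toReal hM] at this
  rw [← ENNReal.ofReal_mul hM', ← ENNReal.ofReal_ofNat 2,
    ← ENNReal.ofReal_inv_of_pos two_pos]
  refine ENNReal.ofReal_le_ofReal ?_
  rw [mul_one_div, div_le_iff₀ (by positivity)]
  linarith

theorem ENNReal.le_two_mul_of_le_add_half {a b : ℝ≥0∞} (ha : a ≠ ∞) (h : a ≤ b + 2⁻¹ * a) :
    a ≤ 2 * b := by
  have ha2 : 2⁻¹ * a ≠ ∞ := ENNReal.mul_ne_top (by simp) ha
  have h1 : 2⁻¹ * a ≤ b := by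
    refine (ENNReal.add_le_add_iff_right ha2).1 ?_
    rwa [← add_mul, ENNReal.inv_two_add_inv_two, one_mul]
  calc a = 2 * (2⁻¹ * a) := by
        rw [← mul_assoc, ENNReal.mul_inv_cancel two_ne_zero ENNReal.ofNat_ne_top, one_mul]
    _ ≤ 2 * b := by gcongr

theorem theoremp {X : Type*} [MetricSpace X] [Nontrivial X] [MeasurableSpace X] [BorelSpace X]
    (μ : Measure X) (hμ : IsDoublingMeasure μ)
    (p q s : ℝ) (hq : 1 < q) (hqp : q < p) (hs0 : 0 < s) (hs1 : s < 1)
    (E : Set X) (hE : IsClosed E) (hEA : UpperAikawa μ E (s * q)) :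
    ∃ C : ℝ, 0 < C ∧
      ∀ z ∈ E, ∀ r : ℝ, 0 < r → ENNReal.ofReal r < scaleBound E →
        ∀ u : X → ℝ, (∃ L : ℝ≥0, LipschitzWith L u) →
          (∀ x ∈ truncation E z r, u x = 0) →
            ∫⁻ x in ball z (8 * r) \ truncation E z r,
                ENNReal.ofReal (|u x| ^ p) / infEDist x (truncation E z r) ^ (s * p) ∂μ
              ≤ ENNReal.ofReal C * fractionalEnergy μ s p (ball z (8 * r)) u := by
  have hp : 1 ≤ p := by linarith
  obtain ⟨κ, hκ, hpt⟩ := hEA.pointwise_hardy hμ hE hp (σ := s * p) (by nlinarith)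
  obtain ⟨M, hM, hop⟩ := hμ.lintegral_kernel_operator_le
    (α := s * q) (σ := s * p) (mul_lt_mul_of_pos_left hqp hs0)
  -- Neither `κ` nor `M` depends on `ε`, so the error term can be made at most half of the left-hand
  -- side.
  obtain ⟨ε, hε, hεM⟩ := ENNReal.exists_mul_ofReal_le_half (ENNReal.mul_ne_top hκ hM)
  obtain ⟨A, hA, hpt⟩ := hpt ε hε
  have hA2 : 2 * A ≠ ∞ := ENNReal.mul_ne_top ENNReal.ofNat_ne_top hA
  -- The `+ 1` only ensures a positive constant.
  refine ⟨(2 * A).toReal + 1, by positivity, ?_⟩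
  rintro z hz r hr hrE u ⟨L, hu⟩ hu0
  have hum : Measurable u := hu.continuous.measurable
  have hpt := hpt z hz r hr hrE u hum hu0
  have hzF : z ∈ truncation E z r :=
    truncationStep_subset_truncation 0 (mem_truncationStep_zero hz hr)
  have hF : IsClosed (truncation E z r) := isClosed_closure
  have hΩ : MeasurableSet (ball z (8 * r) \ truncation E z r) :=
    measurableSet_ball.diff hF.measurableSet
  have hdisj : Disjoint (ball z (8 * r) \ truncation E z r) (truncation E z r) :=
    disjoint_sdiff_left
  obtain ⟨hGm, hG⟩ := hop _ _ hF ⟨z, hzF⟩ hΩ hdisj (fun y => ENNReal.ofReal (|u y| ^ p))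
    (by fun_prop)
  have hfin := lintegral_abs_rpow_div_infEDist_lt_top (μ := μ) hF ⟨z, hzF⟩ hΩ hdisj
    (ne_top_of_le_ne_top (hμ.ball_lt_top z (8 * r) (by positivity)).ne (measure_mono sdiff_subset))
    (d := 8 * r) (fun x hx => (infDist_le_dist_of_mem hzF).trans (mem_ball.1 hx.1).le) hu hu0
    (p := p) (σ := s * p) (by linarith) (by nlinarith)
  set H := ∫⁻ x in ball z (8 * r) \ truncation E z r,
    ENNReal.ofReal (|u x| ^ p) / infEDist x (truncation E z r) ^ (s * p) ∂μ with hH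
  have hκε : κ * ENNReal.ofReal ε ≠ ∞ := ENNReal.mul_ne_top hκ ENNReal.ofReal_ne_top
  have hmain : H ≤ A * fractionalEnergy μ s p (ball z (8 * r)) u + 2⁻¹ * H := by
    refine (setLIntegral_mono' hΩ hpt).trans ?_
    rw [lintegral_add_right _ (hGm.const_mul _), lintegral_const_mul' _ _ hA,
      lintegral_const_mul' _ _ hκε]
    refine add_le_add (mul_le_mul' le_rfl (lintegral_mono_set sdiff_subset)) ?_
    calc _ ≤ κ * ENNReal.ofReal ε * (M * H) := mul_le_mul' le_rfl hG
      _ = κ * M * ENNReal.ofReal ε * H := by ring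
      _ ≤ 2⁻¹ * H := by gcongr
  calc H ≤ 2 * (A * fractionalEnergy μ s p (ball z (8 * r)) u) :=
        ENNReal.le_two_mul_of_le_add_half hfin.ne hmain
    _ = 2 * A * fractionalEnergy μ s p (ball z (8 * r)) u := by ring
    _ ≤ _ := by
        gcongr
        rw [← ENNReal.ofReal_toReal hA2]
        exact ENNReal.ofReal_le_ofReal (by simp)
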